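/- Let $K$ be a metrizable compact space and let $C(K)$ be the Banach space of continuous functions $K\to\mathbb R$ with the supremum norm. Let $X$ and $Y$ be $C(K)$-valued random variables, each defined on a probability space (possibly the same one), and measurable with respect to the $\sigma$-field $\mathcal C$ on $C(K)$ generated by the point evaluations $f\mapsto f(t)$, $t\in K$. Suppose that $\sup_{t\in K}\mathbb E|X(t)|^2<\infty$ and $\sup_{t\in K}\mathbb E|Y(t)|^2<\infty$. Then the following are equivalent (each equality of expectations includes the statement that both expectations exist): (i) $\mathbb E\,\alpha(X,X)=\mathbb E\,\alpha(Y,Y)$ for every bounded bilinear form $\alpha: C(K)\times C(K)\to\mathbb R$. (ii) $\mathbb E\big(x_1^*(X)\,x_2^*(X)\big)=\mathbb E\big(x_1^*(Y)\,x_2^*(Y)\big)$ for all $x_1^*,x_2^*\in C(K)^*$. (iii) $\mathbb E\big(X(t_1)X(t_2)\big)=\mathbb E\big(Y(t_1)Y(t_2)\big)$ for all $t_1,t_2\in K$. (iv) The projective second moments of $X$ and $Y$, that is, the expectations of $X\otimes X$ and of $Y\otimes Y$ in the completed projective tensor product $C(K)\mathbin{\widehat\otimes}_\pi C(K)$, exist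 in Dunford sense and are equal. (v) The injective second moments of $X$ and $Y$, that is, the expectations of $X\otimes X$ and of $Y\otimes Y$ in the completed injective tensor product $C(K)\mathbin{\widehat\otimes}_\varepsilon C(K)$, exist in Dunford sense and are equal. Here the expectation of a random variable $Z$ with values in a Banach space $V$ exists in Dunford sense if $\ell(Z)$ is integrable for every $\ell\in V^*$; it is then the element $\mathbb E Z$ of the bidual $V^{**}$ with $\langle \mathbb E Z,\ell\rangle=\mathbb E\,\ell(Z)$ for all $\ell\in V^*$. -/

import Mathlib

open MeasureTheory
open scoped TensorProduct ENNReal NNReal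

/-- The two real random variables `f` (on `(Ω, μ)`) and `g` (on `(Ω', ν)`) both have an expectation
(they are integrable), and the two expectations are equal. -/
def EqualExpectations {Ω Ω' : Type*} [MeasurableSpace Ω] [MeasurableSpace Ω']
    (μ : Measure Ω) (ν : Measure Ω') (f : Ω → ℝ) (g : Ω' → ℝ) : Prop :=
  Integrable f μ ∧ Integrable g ν ∧ ∫ ω, f ω ∂μ = ∫ ω, g ω ∂ν

/-- `m`, an element of the bidual of `V`, is the Dunford integral of `Z : Ω → V`: every continuous
linear functional of `Z` is integrable, and `⟨m, ℓ⟩ = E ℓ(Z)` for each of them.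
Such an `m` is unique if it exists. -/
structure IsDunfordIntegral {Ω V : Type*} [MeasurableSpace Ω] [NormedAddCommGroup V]
    [NormedSpace ℝ V] (μ : Measure Ω) (Z : Ω → V) (m : StrongDual ℝ (StrongDual ℝ V)) : Prop where
  integrable : ∀ ℓ : StrongDual ℝ V, Integrable (fun ω => ℓ (Z ω)) μ
  apply_eq : ∀ ℓ : StrongDual ℝ V, m ℓ = ∫ ω, ℓ (Z ω) ∂μ

section TensorPowers

variable (k : ℕ) (B : Type*) [NormedAddCommGroup B] [NormedSpace ℝ B]

/-- The projective tensor power of `B` of order `k`: the completion of the algebraic tensor power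
for the projective tensor norm
`‖u‖ = inf {∑ⱼ ∏ᵢ ‖xᵢⱼ‖ : u = ∑ⱼ x₁ⱼ ⊗ ⋯ ⊗ x_kⱼ}`, which is the norm that Mathlib puts on
`⨂[ℝ] i, B`. -/
abbrev ProjTensorPower : Type _ :=
  UniformSpace.Completion (⨂[ℝ] _ : Fin k, B)

variable {B} in
/-- The elementary tensor `x ⊗ ⋯ ⊗ x` in the projective tensor power. -/
noncomputable def projPow (x : B) : ProjTensorPower k B :=
  ((PiTensorProduct.tprod ℝ (fun _ : Fin k => x) : ⨂[ℝ] _ : Fin k, B) :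
    UniformSpace.Completion (⨂[ℝ] _ : Fin k, B))

variable {k B} in
/-- The linear functional on the algebraic tensor power of `B` determined by
`x₁ ⊗ ⋯ ⊗ x_k ↦ ξ₁(x₁) ⋯ ξ_k(x_k)`. -/
noncomputable def tensorPairing (ξ : Fin k → StrongDual ℝ B) : (⨂[ℝ] _ : Fin k, B) →ₗ[ℝ] ℝ :=
  PiTensorProduct.lift
    ((ContinuousMultilinearMap.mkPiAlgebra ℝ (Fin k) ℝ).compContinuousLinearMap ξ).toMultilinearMap

variable {k B} in
theorem tensorPairing_tprod (ξ : Fin k → StrongDual ℝ B) (x : Fin k → B) :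
    tensorPairing ξ (PiTensorProduct.tprod ℝ x) = ∏ i, ξ i (x i) := by
  simp [tensorPairing]

/-- Families of `k` functionals in the closed unit ball of the dual of `B`. -/
abbrev DualBallFamily : Type _ := Fin k → Metric.closedBall (0 : StrongDual ℝ B) 1

variable {k B} in
theorem bddAbove_tensorPairing (u : ⨂[ℝ] _ : Fin k, B) :
    BddAbove (Set.range fun ξ : DualBallFamily k B => |tensorPairing (fun i => (ξ i).1) u|) := by
  refine ⟨‖u‖, ?_⟩
  rintro _ ⟨ξ, rfl⟩
  have h := PiTensorProduct.norm_eval_le_projectiveSeminorm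
    ((ContinuousMultilinearMap.mkPiAlgebra ℝ (Fin k) ℝ).compContinuousLinearMap
      (fun i => (ξ i).1)) u
  refine h.trans (mul_le_of_le_one_left (norm_nonneg u) ?_)
  refine (ContinuousMultilinearMap.norm_compContinuousLinearMap_le _ _).trans ?_
  rw [ContinuousMultilinearMap.norm_mkPiAlgebra, one_mul]
  exact Finset.prod_le_one (fun i _ => norm_nonneg _)
    (fun i _ => mem_closedBall_zero_iff.mp (ξ i).2)

/-- The injective tensor norm on the algebraic tensor power:
`‖u‖ = sup {|⟨ξ₁ ⊗ ⋯ ⊗ ξ_k, u⟩| : ‖ξ₁‖, …, ‖ξ_k‖ ≤ 1}`. -/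
noncomputable def injTensorSeminorm : Seminorm ℝ (⨂[ℝ] _ : Fin k, B) :=
  Seminorm.ofSMulLE
    (fun u => ⨆ ξ : DualBallFamily k B, |tensorPairing (fun i => (ξ i).1) u|)
    (by simp)
    (fun u v => by
      have : Nonempty (DualBallFamily k B) := ⟨fun _ => ⟨0, by simp⟩⟩
      refine ciSup_le fun ξ => ?_
      rw [map_add]
      exact (abs_add_le _ _).trans (add_le_add (le_ciSup (bddAbove_tensorPairing u) ξ)
        (le_ciSup (bddAbove_tensorPairing v) ξ)))
    (fun r u => by
      have : Nonempty (DualBallFamily k B) := ⟨fun _ => ⟨0, by simp⟩⟩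
      refine ciSup_le fun ξ => ?_
      rw [map_smul, smul_eq_mul, abs_mul, Real.norm_eq_abs]
      exact mul_le_mul_of_nonneg_left (le_ciSup (bddAbove_tensorPairing u) ξ) (abs_nonneg r))

/-- The algebraic tensor power of `B`, to be normed by the injective tensor norm. -/
def AlgInjTensorPower : Type _ := ⨂[ℝ] _ : Fin k, B

noncomputable instance : AddCommGroup (AlgInjTensorPower k B) :=
  inferInstanceAs (AddCommGroup (⨂[ℝ] _ : Fin k, B))

noncomputable instance : Module ℝ (AlgInjTensorPower k B) :=
  inferInstanceAs (Module ℝ (⨂[ℝ] _ : Fin k, B))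

/-- The identity map to the algebraic tensor power with the injective tensor norm. -/
noncomputable def toAlgInj : (⨂[ℝ] _ : Fin k, B) ≃ₗ[ℝ] AlgInjTensorPower k B :=
  LinearEquiv.refl ℝ (⨂[ℝ] _ : Fin k, B)

noncomputable instance : SeminormedAddCommGroup (AlgInjTensorPower k B) :=
  AddGroupSeminorm.toSeminormedAddCommGroup
    ((injTensorSeminorm k B).comp (toAlgInj k B).symm.toLinearMap).toAddGroupSeminorm

noncomputable instance : NormedSpace ℝ (AlgInjTensorPower k B) where
  norm_smul_le r u :=
    (map_smul_eq_mul ((injTensorSeminorm k B).comp (toAlgInj k B).symm.toLinearMap) r u).le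

theorem norm_toAlgInj (u : ⨂[ℝ] _ : Fin k, B) :
    ‖toAlgInj k B u‖ = ⨆ ξ : DualBallFamily k B, |tensorPairing (fun i => (ξ i).1) u| :=
  rfl

/-- The injective tensor power of `B` of order `k`: the completion of the algebraic tensor power
for the injective tensor norm. -/
abbrev InjTensorPower : Type _ :=
  UniformSpace.Completion (AlgInjTensorPower k B)

variable {B} in
/-- The elementary tensor `x ⊗ ⋯ ⊗ x` in the injective tensor power. -/
noncomputable def injPow (x : B) : InjTensorPower k B :=
  (toAlgInj k B (PiTensorProduct.tprod ℝ (fun _ : Fin k => x)) :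
    UniformSpace.Completion (AlgInjTensorPower k B))

end TensorPowers

/-- The `k`-th projective moments of `X` and `Y` exist in Dunford sense and are equal,
as elements of the bidual of the projective tensor power. -/
def EqualProjMomentsDunford {Ω Ω' B : Type*} [MeasurableSpace Ω] [MeasurableSpace Ω']
    [NormedAddCommGroup B] [NormedSpace ℝ B] (k : ℕ) (μ : Measure Ω) (ν : Measure Ω')
    (X : Ω → B) (Y : Ω' → B) : Prop :=
  ∃ m : StrongDual ℝ (StrongDual ℝ (ProjTensorPower k B)),
    IsDunfordIntegral μ (fun ω => projPow k (X ω)) m ∧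
    IsDunfordIntegral ν (fun ω => projPow k (Y ω)) m

/-- The `k`-th injective moments of `X` and `Y` exist in Dunford sense and are equal,
as elements of the bidual of the injective tensor power. -/
def EqualInjMomentsDunford {Ω Ω' B : Type*} [MeasurableSpace Ω] [MeasurableSpace Ω']
    [NormedAddCommGroup B] [NormedSpace ℝ B] (k : ℕ) (μ : Measure Ω) (ν : Measure Ω')
    (X : Ω → B) (Y : Ω' → B) : Prop :=
  ∃ m : StrongDual ℝ (StrongDual ℝ (InjTensorPower k B)),
    IsDunfordIntegral μ (fun ω => injPow k (X ω)) m ∧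
    IsDunfordIntegral ν (fun ω => injPow k (Y ω)) m

/-- The σ-field on `C(K)` generated by the point evaluations `f ↦ f t`, `t ∈ K`. -/
@[reducible]
def pointEvalSigma (K : Type*) [TopologicalSpace K] : MeasurableSpace C(K, ℝ) :=
  ⨆ t : K, MeasurableSpace.comap (fun f : C(K, ℝ) => f t) (borel ℝ)

/-! The content is (iii) implies (i). A process `X` with bounded second moments pointwise may have
non-integrable `‖X‖ ^ 2`, so neither the integrability of `α(X, X)` nor passage to a limit under the
expectation is automatic.

Partitions of unity give finite rank operators `π` with `π f → f`, and `α(π f, ρ g)` is a finite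
matrix form in point values of `f` and `g`. The matrix is bounded by `‖α‖` on sup-norm balls, so
Grothendieck's inequality in `L²(P)` gives `E|α(π U, ρ W)| ≤ 8‖α‖ab` whenever the evaluations of `U`
and `W` have `L²` norms at most `a` and `b`; Fatou removes `π` and `ρ`
(`IsL2Process.lintegral_bilin_le`).

To show `E α(X, π_m X) → E α(X, X)`, a gliding hump replaces domination. If processes `Z_m → 0` had
`E|α(X, Z_m)| ≥ δ` for infinitely many `m`, then `N` of these variables could be nearly concentrated
on disjoint sets `A_k`. The glued process `∑ 1_{A_k} Z_{m_k}` has `L²` bound only `b√N`, while its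
form has mean absolute value at least `Nδ/2`: impossible for large `N`. Applied to each argument in
turn, this reduces (i) to (iii).

The uniform bound also makes `ℓ ↦ E ℓ(X ⊗ X)` bounded on the dual of either tensor square, giving
(iv) and (v); conversely, products of point evaluations are functionals there. -/

/-! ### Grothendieck's inequality by truncated Rademacher sums -/

section Grothendieck

/-- The Rademacher sum `∑ k, ± x k`, as a function of the signs. -/
def rademacherSum {n : ℕ} (x : Fin n → ℝ) (ε : Fin n → Bool) : ℝ :=
  ∑ k, (if ε k then 1 else -1) * x k

theorem sum_signs_succ {n : ℕ} (f : (Fin (n + 1) → Bool) → ℝ) :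
    ∑ ε, f ε = ∑ ε : Fin n → Bool, (f (Fin.cons true ε) + f (Fin.cons false ε)) := by
  rw [← Fintype.sum_equiv (Fin.consEquiv fun _ => Bool) (fun p => f (Fin.cons p.1 p.2)) f
    (fun p => rfl), Fintype.sum_prod_type, Fintype.sum_bool, Finset.sum_add_distrib]

theorem rademacherSum_cons {n : ℕ} (x : Fin (n + 1) → ℝ) (b : Bool) (ε : Fin n → Bool) :
    rademacherSum x (Fin.cons b ε) =
      (if b then 1 else -1) * x 0 + rademacherSum (fun k => x k.succ) ε := by
  simp [rademacherSum, Fin.sum_univ_succ]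

theorem sum_rademacherSum_mul {n : ℕ} (x y : Fin n → ℝ) :
    ∑ ε, rademacherSum x ε * rademacherSum y ε = 2 ^ n * ∑ k, x k * y k := by
  induction n with
  | zero => simp [rademacherSum]
  | succ n ih =>
    rw [sum_signs_succ, Fin.sum_univ_succ]
    have h := ih (fun k => x k.succ) (fun k => y k.succ)
    have h2 : ∀ ε : Fin n → Bool,
        rademacherSum x (Fin.cons true ε) * rademacherSum y (Fin.cons true ε) +
          rademacherSum x (Fin.cons false ε) * rademacherSum y (Fin.cons false ε) =
        2 * (x 0 * y 0) + 2 * (rademacherSum (fun k => x k.succ) ε *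
          rademacherSum (fun k => y k.succ) ε) := fun ε => by
      simp only [rademacherSum_cons]; norm_num; ring
    rw [Finset.sum_congr rfl fun ε _ => h2 ε, Finset.sum_add_distrib]
    simp only [← Finset.mul_sum, h]
    simp
    ring

/-- Khinchin's inequality for the fourth moment. Averaging over the first sign kills the odd powers,
and the induction closes because `x⁴ + 6x²s + 3s² ≤ 3(x² + s)²`. -/
theorem sum_rademacherSum_pow_four_le {n : ℕ} (x : Fin n → ℝ) :
    ∑ ε, rademacherSum x ε ^ 4 ≤ 2 ^ n * (3 * (∑ k, x k ^ 2) ^ 2) := by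
  induction n with
  | zero => simp [rademacherSum]
  | succ n ih =>
    rw [sum_signs_succ, Fin.sum_univ_succ]
    have h := ih (fun k => x k.succ)
    have h1 := sum_rademacherSum_mul (fun k => x k.succ) (fun k => x k.succ)
    have h2 : ∀ ε : Fin n → Bool,
        rademacherSum x (Fin.cons true ε) ^ 4 + rademacherSum x (Fin.cons false ε) ^ 4 =
        2 * x 0 ^ 4 + 12 * x 0 ^ 2 * (rademacherSum (fun k => x k.succ) ε *
          rademacherSum (fun k => x k.succ) ε) +
          2 * rademacherSum (fun k => x k.succ) ε ^ 4 := fun ε => by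
      simp only [rademacherSum_cons]; norm_num; ring
    rw [Finset.sum_congr rfl fun ε _ => h2 ε, Finset.sum_add_distrib, Finset.sum_add_distrib]
    simp only [← Finset.mul_sum, h1]
    simp only [← pow_two]
    simp only [Finset.sum_const, Finset.card_univ, Fintype.card_pi, Fintype.card_bool,
      Finset.prod_const, Fintype.card_fin, nsmul_eq_mul, Nat.cast_pow, Nat.cast_ofNat]
    have h3 : (0 : ℝ) ≤ 2 ^ n * x 0 ^ 4 := by positivity
    generalize ∑ ε, rademacherSum (fun k => x k.succ) ε ^ 4 = M at h ⊢
    generalize ∑ k, x (Fin.succ k) ^ 2 = s at h ⊢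
    calc _ = 2 * (2 ^ n * x 0 ^ 4) + 12 * (2 ^ n * x 0 ^ 2 * s) + 2 * M := by ring
      _ ≤ 2 * (2 ^ n * x 0 ^ 4) + 12 * (2 ^ n * x 0 ^ 2 * s) + 2 * (2 ^ n * (3 * s ^ 2)) +
        4 * (2 ^ n * x 0 ^ 4) := by linarith
      _ = _ := by ring

/-- Truncation at height `2`. -/
noncomputable def clipTwo (r : ℝ) : ℝ := max (-2) (min 2 r)

theorem abs_clipTwo_le (r : ℝ) : |clipTwo r| ≤ 2 :=
  abs_le.2 ⟨le_max_left _ _, max_le (by norm_num) (min_le_left _ _)⟩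

theorem clipTwo_sq_le (r : ℝ) : clipTwo r ^ 2 ≤ r ^ 2 := by
  unfold clipTwo
  rcases le_total 2 r with h | h
  · rw [min_eq_left h, max_eq_right (by norm_num)]; nlinarith
  · rw [min_eq_right h]
    rcases le_total (-2) r with h' | h'
    · rw [max_eq_right h']
    · rw [max_eq_left h']; nlinarith

theorem sub_clipTwo_sq_le (r : ℝ) : (r - clipTwo r) ^ 2 ≤ r ^ 4 / 64 := by
  -- For `r ≥ 2` this is `(r - 4)² ≥ 0`, and symmetrically for `r ≤ -2`.
  have key : |r - clipTwo r| ≤ r ^ 2 / 8 := by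
    unfold clipTwo
    rcases le_total 2 r with h | h
    · rw [min_eq_left h, max_eq_right (by norm_num), abs_le]
      constructor <;> nlinarith [sq_nonneg (r - 4)]
    · rw [min_eq_right h]
      rcases le_total (-2) r with h' | h'
      · rw [max_eq_right h']; simp; positivity
      · rw [max_eq_left h', abs_le]
        constructor <;> nlinarith [sq_nonneg (r + 4)]
  calc (r - clipTwo r) ^ 2 = |r - clipTwo r| ^ 2 := (sq_abs _).symm
    _ ≤ (r ^ 2 / 8) ^ 2 := pow_le_pow_left₀ (abs_nonneg _) key 2
    _ = r ^ 4 / 64 := by ring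

variable {ι ι' : Type*} [Fintype ι] [Fintype ι']

/-- `C` bounds the form `∑ a i j ⟨x i, y j⟩` on vectors of the Euclidean unit balls. -/
def EuclideanFormBound (a : ι → ι' → ℝ) (C : ℝ) : Prop :=
  ∀ (n : ℕ) (x : ι → Fin n → ℝ) (y : ι' → Fin n → ℝ), (∀ i, ∑ k, x i k ^ 2 ≤ 1) →
    (∀ j, ∑ k, y j k ^ 2 ≤ 1) → |∑ i, ∑ j, a i j * ∑ k, x i k * y j k| ≤ C

theorem EuclideanFormBound.fintype {a : ι → ι' → ℝ} {C : ℝ} (h : EuclideanFormBound a C)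
    {κ : Type*} [Fintype κ] (x : ι → κ → ℝ) (y : ι' → κ → ℝ) (hx : ∀ i, ∑ k, x i k ^ 2 ≤ 1)
    (hy : ∀ j, ∑ k, y j k ^ 2 ≤ 1) : |∑ i, ∑ j, a i j * ∑ k, x i k * y j k| ≤ C := by
  let e := Fintype.equivFin κ
  have := h _ (fun i k => x i (e.symm k)) (fun j k => y j (e.symm k))
    (fun i => by rw [Equiv.sum_comp e.symm (fun k => x i k ^ 2)]; exact hx i)
    (fun j => by rw [Equiv.sum_comp e.symm (fun k => y j k ^ 2)]; exact hy j)
  refine le_of_eq_of_le ?_ this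
  congr 1
  refine Finset.sum_congr rfl fun i _ => Finset.sum_congr rfl fun j _ => ?_
  rw [Equiv.sum_comp e.symm (fun k => x i k * y j k)]

/-- Homogeneity: vectors of length `√w / 4` against vectors of length `√w`. In the application `w =
2 ^ n` counts the signs. -/
theorem EuclideanFormBound.weighted {a : ι → ι' → ℝ} {C : ℝ} (h : EuclideanFormBound a C)
    {κ : Type*} [Fintype κ] (x : ι → κ → ℝ) (y : ι' → κ → ℝ) {w : ℝ} (hw : 0 < w)
    (hx : ∀ i, ∑ k, x i k ^ 2 ≤ w / 16)
    (hy : ∀ j, ∑ k, y j k ^ 2 ≤ w) :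
    |∑ i, ∑ j, a i j * ∑ k, x i k * y j k| ≤ w * (C / 4) := by
  have hs : √w ≠ 0 := (Real.sqrt_pos.2 hw).ne'
  have hs2 : √w ^ 2 = w := Real.sq_sqrt hw.le
  have := h.fintype (fun i k => 4 / √w * x i k) (fun j k => 1 / √w * y j k)
    (fun i => by
      simp only [mul_pow, ← Finset.mul_sum, div_pow, hs2]
      calc 4 ^ 2 / w * ∑ k, x i k ^ 2 ≤ 4 ^ 2 / w * (w / 16) := by gcongr; exact hx i
        _ = 1 := by field_simp; norm_num)
    (fun j => by
      simp only [mul_pow, ← Finset.mul_sum, div_pow, hs2]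
      calc 1 ^ 2 / w * ∑ k, y j k ^ 2 ≤ 1 ^ 2 / w * w := by gcongr; exact hy j
        _ = 1 := by field_simp)
  have e : ∑ i, ∑ j, a i j * ∑ k, 4 / √w * x i k * (1 / √w * y j k) =
      4 / w * ∑ i, ∑ j, a i j * ∑ k, x i k * y j k := by
    simp only [Finset.mul_sum]
    refine Finset.sum_congr rfl fun i _ => Finset.sum_congr rfl fun j _ =>
      Finset.sum_congr rfl fun k _ => ?_
    have e4 : 4 / w = 4 / √w * (1 / √w) := by rw [div_mul_div_comm, ← pow_two, hs2, mul_one]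
    rw [e4]; ring
  rw [e, abs_mul, abs_of_pos (by positivity)] at this
  calc _ = w / 4 * (4 / w * |∑ i, ∑ j, a i j * ∑ k, x i k * y j k|) := by field_simp
    _ ≤ w / 4 * C := by gcongr
    _ = _ := by ring

/-- Rademacher sums represent `⟨x, y⟩` as the mean of `G_x G_y`. The parts truncated at height 2 are
covered by the sup-norm bound, at cost `2 · 2 · A`; each of the two terms with a remainder costs `C
/ 4`, since remainders have `L²` norm at most `1/4`. -/
theorem EuclideanFormBound.of_sup {a : ι → ι' → ℝ} {A C : ℝ}
    (ha : ∀ (p : ι → ℝ) (q : ι' → ℝ), (∀ i, |p i| ≤ 1) → (∀ j, |q j| ≤ 1) →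
      |∑ i, ∑ j, a i j * (p i * q j)| ≤ A) (h : EuclideanFormBound a C) :
    EuclideanFormBound a (4 * A + C / 2) := by
  intro n x y hx hy
  set G : (Fin n → ℝ) → (Fin n → Bool) → ℝ := rademacherSum with hG
  have hw : (0 : ℝ) < 2 ^ n := by positivity
  have hG2 : ∀ z : Fin n → ℝ, ∑ k, z k ^ 2 ≤ 1 → ∑ ε, G z ε ^ 2 ≤ 2 ^ n := fun z hz => by
    have := sum_rademacherSum_mul z z
    simp only [← pow_two] at this
    rw [hG, this]
    exact mul_le_of_le_one_right hw.le hz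
  have hT2 : ∀ z : Fin n → ℝ, ∑ k, z k ^ 2 ≤ 1 → ∑ ε, clipTwo (G z ε) ^ 2 ≤ 2 ^ n :=
    fun z hz => (Finset.sum_le_sum fun ε _ => clipTwo_sq_le _).trans (hG2 z hz)
  -- The fourth moment bound gives `3/64` per sign, which is below `1/16`.
  have hR2 : ∀ z : Fin n → ℝ, ∑ k, z k ^ 2 ≤ 1 →
      ∑ ε, (G z ε - clipTwo (G z ε)) ^ 2 ≤ 2 ^ n / 16 := fun z hz => by
    refine (Finset.sum_le_sum fun ε _ => sub_clipTwo_sq_le _).trans ?_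
    rw [← Finset.sum_div]
    have h0 : 0 ≤ ∑ k, z k ^ 2 := Finset.sum_nonneg fun _ _ => sq_nonneg _
    have h1 := sum_rademacherSum_pow_four_le z
    have h2 : 2 ^ n * (3 * (∑ k, z k ^ 2) ^ 2) ≤ 2 ^ n * (3 * 1) := by
      gcongr
      exact pow_le_one₀ h0 hz
    rw [hG]
    linarith
  have h1 : |∑ i, ∑ j, a i j * ∑ ε, clipTwo (G (x i) ε) * clipTwo (G (y j) ε)| ≤
      2 ^ n * (4 * A) := by
    have e : ∑ i, ∑ j, a i j * ∑ ε, clipTwo (G (x i) ε) * clipTwo (G (y j) ε) =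
        ∑ ε, 4 * ∑ i, ∑ j, a i j * (clipTwo (G (x i) ε) / 2 * (clipTwo (G (y j) ε) / 2)) := by
      simp only [Finset.mul_sum]
      rw [Finset.sum_comm]
      rw [Finset.sum_congr rfl fun j _ => Finset.sum_congr rfl fun i _ => rfl]
      rw [Finset.sum_comm, Finset.sum_congr rfl fun i _ => Finset.sum_comm, Finset.sum_comm]
      refine Finset.sum_congr rfl fun ε _ => Finset.sum_congr rfl fun i _ =>
        Finset.sum_congr rfl fun j _ => ?_
      ring
    rw [e]
    refine (Finset.abs_sum_le_sum_abs _ _).trans ?_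
    have : ∀ ε ∈ (Finset.univ : Finset (Fin n → Bool)),
        |4 * ∑ i, ∑ j, a i j * (clipTwo (G (x i) ε) / 2 * (clipTwo (G (y j) ε) / 2))| ≤
          4 * A := fun ε _ => by
      rw [abs_mul, abs_of_pos (by norm_num : (0 : ℝ) < 4)]
      gcongr
      have hc : ∀ r, |clipTwo r / 2| ≤ 1 := fun r => by
        rw [abs_div, abs_of_pos (by norm_num : (0 : ℝ) < 2)]
        linarith [abs_clipTwo_le r]
      exact ha _ _ (fun i => hc _) (fun j => hc _)
    refine (Finset.sum_le_card_nsmul _ _ _ this).trans ?_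
    simp
  have h2 := h.weighted (fun i ε => G (x i) ε - clipTwo (G (x i) ε)) (fun j => G (y j)) hw
    (fun i => hR2 _ (hx i)) (fun j => hG2 _ (hy j))
  have h3 : |∑ i, ∑ j, a i j *
      ∑ ε, clipTwo (G (x i) ε) * (G (y j) ε - clipTwo (G (y j) ε))| ≤ 2 ^ n * (C / 4) := by
    have hflip : EuclideanFormBound (fun j i => a i j) C := fun n x y hx hy => by
      have := h n y x hy hx
      rw [Finset.sum_comm] at this
      simpa only [mul_comm] using this
    have := hflip.weighted (fun j ε => G (y j) ε - clipTwo (G (y j) ε))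
      (fun i ε => clipTwo (G (x i) ε)) hw (fun j => hR2 _ (hy j)) (fun i => hT2 _ (hx i))
    rw [Finset.sum_comm] at this
    simp only [mul_comm (clipTwo _)]
    exact this
  -- With `T` the truncation and `R = G - T`: `G G' = T T' + R G' + T R'`.
  have e : 2 ^ n * ∑ i, ∑ j, a i j * ∑ k, x i k * y j k =
      ∑ i, ∑ j, a i j * ∑ ε, clipTwo (G (x i) ε) * clipTwo (G (y j) ε) +
      ∑ i, ∑ j, a i j * ∑ ε, (G (x i) ε - clipTwo (G (x i) ε)) * G (y j) ε +
      ∑ i, ∑ j, a i j * ∑ ε, clipTwo (G (x i) ε) * (G (y j) ε - clipTwo (G (y j) ε)) := by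
    rw [← Finset.sum_add_distrib, ← Finset.sum_add_distrib, Finset.mul_sum]
    refine Finset.sum_congr rfl fun i _ => ?_
    rw [← Finset.sum_add_distrib, ← Finset.sum_add_distrib, Finset.mul_sum]
    refine Finset.sum_congr rfl fun j _ => ?_
    rw [← mul_add, ← mul_add, ← Finset.sum_add_distrib, ← Finset.sum_add_distrib, mul_left_comm,
      ← sum_rademacherSum_mul]
    congr 1
    refine Finset.sum_congr rfl fun ε _ => ?_
    rw [hG]; ring
  have h4 := abs_add_le (∑ i, ∑ j, a i j * ∑ ε, clipTwo (G (x i) ε) * clipTwo (G (y j) ε) +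
      ∑ i, ∑ j, a i j * ∑ ε, (G (x i) ε - clipTwo (G (x i) ε)) * G (y j) ε)
    (∑ i, ∑ j, a i j * ∑ ε, clipTwo (G (x i) ε) * (G (y j) ε - clipTwo (G (y j) ε)))
  have h5 := abs_add_le (∑ i, ∑ j, a i j * ∑ ε, clipTwo (G (x i) ε) * clipTwo (G (y j) ε))
    (∑ i, ∑ j, a i j * ∑ ε, (G (x i) ε - clipTwo (G (x i) ε)) * G (y j) ε)
  rw [← e, abs_mul, abs_of_pos hw] at h4
  refine le_of_mul_le_mul_left ?_ hw
  linarith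

theorem euclideanFormBound_sum_abs (a : ι → ι' → ℝ) :
    EuclideanFormBound a (∑ i, ∑ j, |a i j|) := by
  intro n x y hx hy
  refine (Finset.abs_sum_le_sum_abs _ _).trans (Finset.sum_le_sum fun i _ => ?_)
  refine (Finset.abs_sum_le_sum_abs _ _).trans (Finset.sum_le_sum fun j _ => ?_)
  rw [abs_mul]
  refine mul_le_of_le_one_right (abs_nonneg _) ?_
  have := Finset.sum_mul_sq_le_sq_mul_sq Finset.univ (x i) (y j)
  rw [← sq_le_one_iff_abs_le_one]
  exact this.trans (mul_le_one₀ (hx i) (Finset.sum_nonneg fun _ _ => sq_nonneg _) (hy j))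

/-- `8 * A` is the fixed point of `C ↦ 4 * A + C / 2`; iteration from the crude bound `S` halves the
excess each time. -/
theorem euclideanFormBound_eight {a : ι → ι' → ℝ} {A : ℝ}
    (ha : ∀ (p : ι → ℝ) (q : ι' → ℝ), (∀ i, |p i| ≤ 1) → (∀ j, |q j| ≤ 1) →
      |∑ i, ∑ j, a i j * (p i * q j)| ≤ A) : EuclideanFormBound a (8 * A) := by
  set S := ∑ i, ∑ j, |a i j|
  have hA : 0 ≤ A := (abs_nonneg _).trans (ha 0 0 (by simp) (by simp))
  have h : ∀ m : ℕ, EuclideanFormBound a (8 * A + S * (1 / 2) ^ m) := fun m => by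
    induction m with
    | zero =>
      intro n x y hx hy
      refine (euclideanFormBound_sum_abs a n x y hx hy).trans ?_
      simp only [pow_zero, mul_one]
      linarith
    | succ m ih =>
      have := ih.of_sup ha
      convert this using 1
      ring
  intro n x y hx hy
  refine ge_of_tendsto' (x := Filter.atTop)
    (f := fun m : ℕ => 8 * A + S * (1 / 2) ^ m) ?_ fun m => h m n x y hx hy
  have := (tendsto_pow_atTop_nhds_zero_of_lt_one (by norm_num : (0 : ℝ) ≤ 1 / 2)
    (by norm_num)).const_mul S
  simpa using this.const_add (8 * A)

/-- **Grothendieck's inequality**, with the constant `8`. -/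
theorem grothendieck_inequality {a : ι → ι' → ℝ} {A : ℝ}
    (ha : ∀ (p : ι → ℝ) (q : ι' → ℝ), (∀ i, |p i| ≤ 1) → (∀ j, |q j| ≤ 1) →
      |∑ i, ∑ j, a i j * (p i * q j)| ≤ A)
    {E : Type*} [NormedAddCommGroup E] [InnerProductSpace ℝ E] (x : ι → E) (y : ι' → E)
    (hx : ∀ i, ‖x i‖ ≤ 1) (hy : ∀ j, ‖y j‖ ≤ 1) :
    |∑ i, ∑ j, a i j * inner ℝ (x i) (y j)| ≤ 8 * A := by
  -- Finitely many vectors span a Euclidean space, where coordinates are available.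
  let F : Submodule ℝ E := Submodule.span ℝ (Set.range x ∪ Set.range y)
  have : FiniteDimensional ℝ F :=
    FiniteDimensional.span_of_finite ℝ ((Set.finite_range x).union (Set.finite_range y))
  let b := stdOrthonormalBasis ℝ F
  let x' : ι → F := fun i => ⟨x i, Submodule.subset_span (Or.inl ⟨i, rfl⟩)⟩
  let y' : ι' → F := fun j => ⟨y j, Submodule.subset_span (Or.inr ⟨j, rfl⟩)⟩
  have hin : ∀ u v : F, ∑ k, inner ℝ (b k) u * inner ℝ (b k) v = inner ℝ u v := fun u v => by
    rw [← b.sum_inner_mul_inner u v]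
    simp only [real_inner_comm u]
  have hsq : ∀ u : F, ‖u‖ ≤ 1 → ∑ k, inner ℝ (b k) u ^ 2 ≤ 1 := fun u hu => by
    simp only [pow_two]
    rw [hin, real_inner_self_eq_norm_mul_norm]
    exact mul_le_one₀ hu (norm_nonneg _) hu
  have := euclideanFormBound_eight ha _ (fun i k => inner ℝ (b k) (x' i))
    (fun j k => inner ℝ (b k) (y' j)) (fun i => hsq _ (hx i)) (fun j => hsq _ (hy j))
  simp only [hin] at this
  exact this

end Grothendieck

section

set_option maxSynthPendingDepth 3

theorem grothendieck_inequality_of_norm_le {ι ι' : Type*} [Fintype ι] [Fintype ι']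
    {a : ι → ι' → ℝ} {A : ℝ}
    (ha : ∀ (p : ι → ℝ) (q : ι' → ℝ), (∀ i, |p i| ≤ 1) → (∀ j, |q j| ≤ 1) →
      |∑ i, ∑ j, a i j * (p i * q j)| ≤ A)
    {E : Type*} [NormedAddCommGroup E] [InnerProductSpace ℝ E] (x : ι → E) (y : ι' → E)
    {R S : ℝ} (hR : 0 ≤ R) (hS : 0 ≤ S) (hx : ∀ i, ‖x i‖ ≤ R) (hy : ∀ j, ‖y j‖ ≤ S) :
    |∑ i, ∑ j, a i j * inner ℝ (x i) (y j)| ≤ 8 * A * (R * S) := by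
  have hnorm : ∀ {v : E} {r : ℝ}, 0 ≤ r → ‖v‖ ≤ r → ‖r⁻¹ • v‖ ≤ 1 := fun {v r} hr hv => by
    rw [norm_smul, norm_inv, Real.norm_of_nonneg hr]
    exact inv_mul_le_one_of_le₀ hv hr
  -- For `r = 0` the vector vanishes, so the convention `0⁻¹ = 0` is harmless.
  have hscale : ∀ {v : E} {r : ℝ}, ‖v‖ ≤ r → r • r⁻¹ • v = v := fun {v r} hv => by
    rcases eq_or_ne r 0 with rfl | hr
    · simp [norm_le_zero_iff.1 hv]
    · rw [smul_inv_smul₀ hr]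
  have h := grothendieck_inequality ha (fun i => R⁻¹ • x i) (fun j => S⁻¹ • y j)
    (fun i => hnorm hR (hx i)) (fun j => hnorm hS (hy j))
  have e : ∑ i, ∑ j, a i j * inner ℝ (x i) (y j) =
      (R * S) * ∑ i, ∑ j, a i j * inner ℝ (R⁻¹ • x i) (S⁻¹ • y j) := by
    simp only [Finset.mul_sum]
    refine Finset.sum_congr rfl fun i _ => Finset.sum_congr rfl fun j _ => ?_
    conv_lhs => rw [← hscale (hx i), ← hscale (hy j), real_inner_smul_left, real_inner_smul_right]
    ring
  rw [e, abs_mul, abs_of_nonneg (mul_nonneg hR hS), mul_comm]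
  gcongr

/-! ### Finite rank approximation on `C(K)` by partitions of unity -/

/-- A finite partition of unity on `K`, with a point of `K` attached to each of its functions. -/
structure PointedPartition (K : Type*) [TopologicalSpace K] where
  card : ℕ
  pt : Fin card → K
  fn : Fin card → C(K, ℝ)
  nonneg : ∀ i s, 0 ≤ fn i s
  sum_eq_one : ∀ s, ∑ i, fn i s = 1

namespace PointedPartition

variable {K : Type*} [TopologicalSpace K] [CompactSpace K]

/-- The finite rank operator `f ↦ ∑ i, f (pt i) • fn i`. -/
noncomputable def approx (π : PointedPartition K) : C(K, ℝ) →L[ℝ] C(K, ℝ) :=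
  ∑ i, (ContinuousMap.evalCLM ℝ (π.pt i)).smulRight (π.fn i)

theorem approx_eq (π : PointedPartition K) (f : C(K, ℝ)) :
    π.approx f = ∑ i, f (π.pt i) • π.fn i := by
  simp [approx]

theorem approx_apply (π : PointedPartition K) (f : C(K, ℝ)) (s : K) :
    π.approx f s = ∑ i, f (π.pt i) * π.fn i s := by
  simp [approx_eq]

theorem bilin_approx (π ρ : PointedPartition K) (α : C(K, ℝ) →L[ℝ] C(K, ℝ) →L[ℝ] ℝ)
    (f g : C(K, ℝ)) : α (π.approx f) (ρ.approx g) =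
      ∑ i, ∑ j, α (π.fn i) (ρ.fn j) * (f (π.pt i) * g (ρ.pt j)) := by
  simp only [approx_eq, map_sum, map_smul, sum_apply,
    smul_apply, smul_eq_mul, Finset.mul_sum]
  rw [Finset.sum_comm]
  refine Finset.sum_congr rfl fun i _ => Finset.sum_congr rfl fun j _ => ?_
  ring

theorem norm_sum_smul_fn_le (π : PointedPartition K) (p : Fin π.card → ℝ) (hp : ∀ i, |p i| ≤ 1) :
    ‖∑ i, p i • π.fn i‖ ≤ 1 := by
  rw [ContinuousMap.norm_le _ zero_le_one]
  intro s
  rw [← π.sum_eq_one s]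
  simp only [ContinuousMap.coe_sum, ContinuousMap.coe_smul, Finset.sum_apply, Pi.smul_apply,
    smul_eq_mul]
  refine (norm_sum_le _ _).trans (Finset.sum_le_sum fun i _ => ?_)
  rw [norm_mul, Real.norm_of_nonneg (π.nonneg i s)]
  exact mul_le_of_le_one_left (π.nonneg i s) (hp i)

/-- This is the hypothesis of Grothendieck's inequality for the matrix `α (π.fn i) (ρ.fn j)`: convex
combinations of numbers in `[-1, 1]` stay there. -/
theorem abs_sum_bilin_le (π ρ : PointedPartition K) (α : C(K, ℝ) →L[ℝ] C(K, ℝ) →L[ℝ] ℝ)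
    (p : Fin π.card → ℝ) (q : Fin ρ.card → ℝ) (hp : ∀ i, |p i| ≤ 1) (hq : ∀ j, |q j| ≤ 1) :
    |∑ i, ∑ j, α (π.fn i) (ρ.fn j) * (p i * q j)| ≤ ‖α‖ := by
  have e : ∑ i, ∑ j, α (π.fn i) (ρ.fn j) * (p i * q j) =
      α (∑ i, p i • π.fn i) (∑ j, q j • ρ.fn j) := by
    simp only [map_sum, map_smul, sum_apply,
      smul_apply, smul_eq_mul, Finset.mul_sum]
    rw [Finset.sum_comm]
    refine Finset.sum_congr rfl fun i _ => Finset.sum_congr rfl fun j _ => ?_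
    ring
  rw [e, ← Real.norm_eq_abs]
  refine (α.le_opNorm₂ _ _).trans ?_
  have h1 := π.norm_sum_smul_fn_le p hp
  have h2 := ρ.norm_sum_smul_fn_le q hq
  calc ‖α‖ * ‖∑ i, p i • π.fn i‖ * ‖∑ j, q j • ρ.fn j‖ ≤ ‖α‖ * 1 * 1 := by gcongr
    _ = ‖α‖ := by ring

theorem exists_subordinate {K : Type*} [MetricSpace K] [CompactSpace K] {r : ℝ} (hr : 0 < r) :
    ∃ π : PointedPartition K, ∀ i s, π.fn i s ≠ 0 → dist s (π.pt i) < r := by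
  obtain ⟨T, -, hT, hcov⟩ := finite_cover_balls_of_compact (isCompact_univ (X := K)) hr
  have := hT.to_subtype
  obtain ⟨n, ⟨e⟩⟩ := Finite.exists_equiv_fin T
  obtain ⟨f, hf⟩ := PartitionOfUnity.exists_isSubordinate (isClosed_univ (X := K))
    (fun i : Fin n => Metric.ball (e.symm i : K) r) (fun _ => Metric.isOpen_ball) (fun s hs => by
      obtain ⟨t, ht, hst⟩ := Set.mem_iUnion₂.1 (hcov hs)
      exact Set.mem_iUnion.2 ⟨e ⟨t, ht⟩, by simpa using hst⟩)
  refine ⟨⟨n, fun i => e.symm i, fun i => f i, fun i s => f.nonneg i s, fun s => ?_⟩,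
    fun i s hs => hf i (subset_tsupport _ hs)⟩
  have := f.sum_eq_one (Set.mem_univ s)
  rwa [finsum_eq_sum_of_fintype] at this

/-- `(π n).approx f s` averages values of `f` at points within `1 / (n + 1)` of `s`, so uniform
continuity suffices. One sequence serves every `f`. -/
theorem exists_seq_tendsto (K : Type*) [TopologicalSpace K] [CompactSpace K]
    [TopologicalSpace.MetrizableSpace K] :
    ∃ π : ℕ → PointedPartition K, ∀ f : C(K, ℝ),
      Filter.Tendsto (fun n => (π n).approx f) Filter.atTop (nhds f) := by
  let := TopologicalSpace.metrizableSpaceMetric K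
  choose π hπ using fun n : ℕ => exists_subordinate (K := K) (r := 1 / ((n : ℝ) + 1))
    Nat.one_div_pos_of_nat
  refine ⟨π, fun f => ?_⟩
  rw [ContinuousMap.tendsto_iff_tendstoUniformly, Metric.tendstoUniformly_iff]
  intro η hη
  obtain ⟨δ, hδ, hf⟩ := Metric.uniformContinuous_iff.1
    (CompactSpace.uniformContinuous_of_continuous f.continuous) (η / 2) (half_pos hη)
  filter_upwards [(tendsto_one_div_add_atTop_nhds_zero_nat (𝕜 := ℝ)).eventually_lt_const hδ]
    with n hn s
  have e : f s - (π n).approx f s = ∑ i, (f s - f ((π n).pt i)) * (π n).fn i s := by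
    simp only [sub_mul, Finset.sum_sub_distrib, ← Finset.mul_sum, (π n).sum_eq_one, mul_one,
      approx_apply]
  rw [Real.dist_eq, e]
  refine lt_of_le_of_lt ?_ (half_lt_self hη)
  calc _ ≤ ∑ i, η / 2 * (π n).fn i s := by
        refine (Finset.abs_sum_le_sum_abs _ _).trans (Finset.sum_le_sum fun i _ => ?_)
        rw [abs_mul, abs_of_nonneg ((π n).nonneg i s)]
        rcases eq_or_ne ((π n).fn i s) 0 with h | h
        · simp [h]
        · exact mul_le_mul_of_nonneg_right (hf ((hπ n i s h).trans hn)).le ((π n).nonneg i s)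
    _ = η / 2 := by rw [← Finset.mul_sum, (π n).sum_eq_one, mul_one]

end PointedPartition

/-! ### A gliding hump argument in `L¹` -/

section GlidingHump

variable {Ω : Type*} [MeasurableSpace Ω] {P : Measure Ω}

/-- A gliding hump criterion for convergence in `L¹`. -/
theorem tendsto_integral_abs_of_disjoint_bound [IsProbabilityMeasure P] {g : ℕ → Ω → ℝ}
    (hm : ∀ m, Measurable (g m)) (hi : ∀ m, Integrable (g m) P)
    (h0 : ∀ ω, Filter.Tendsto (fun m => g m ω) Filter.atTop (nhds 0)) {C : ℝ}
    (hC : ∀ (N : ℕ) (m : Fin N → ℕ) (A : Fin N → Set Ω), (∀ k, MeasurableSet (A k)) →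
      Pairwise (Function.onFun Disjoint A) → ∑ k, ∫ ω in A k, |g (m k) ω| ∂P ≤ C * √N) :
    Filter.Tendsto (fun m => ∫ ω, |g m ω| ∂P) Filter.atTop (nhds 0) := by
  by_contra hcon
  rw [Metric.tendsto_atTop] at hcon
  push Not at hcon
  obtain ⟨δ, hδ, hfr⟩ := hcon
  obtain ⟨N, hN⟩ := exists_nat_gt ((2 * C / δ) ^ 2)
  have hN0 : (0 : ℝ) < N := (sq_nonneg _).trans_lt hN
  -- Chosen so that the losses `η + N * η` below are at most `δ / 2`.
  set η : ℝ := δ / (4 * N) with hη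
  have hη0 : 0 < η := by positivity
  have hE : ∀ j, MeasurableSet {ω | η < |g j ω|} := fun j =>
    measurableSet_lt measurable_const (hm j).abs
  -- For fixed `i`, dominated convergence: each `ω` eventually leaves the sets `{η < |g j|}`.
  have hlim : ∀ i, Filter.Tendsto
      (fun j => ∫ ω, {ω | η < |g j ω|}.indicator (fun ω => |g i ω|) ω ∂P)
      Filter.atTop (nhds 0) := fun i => by
    have := tendsto_integral_of_dominated_convergence (μ := P)
      (F := fun j => {ω | η < |g j ω|}.indicator (fun ω => |g i ω|)) (f := fun _ => 0)
      (fun ω => |g i ω|) (fun j => ((hm i).abs.indicator (hE j)).aestronglyMeasurable) (hi i).abs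
      (fun j => Filter.Eventually.of_forall fun ω => by
        refine (norm_indicator_le_norm_self _ _).trans ?_
        simp)
      (Filter.Eventually.of_forall fun ω => by
        refine tendsto_const_nhds.congr' ?_
        have h := (h0 ω).abs
        rw [abs_zero] at h
        filter_upwards [h.eventually_lt_const hη0] with j hj
        rw [Set.indicator_of_notMem]
        simpa using hj.le)
    simpa using this
  -- Extracts a subsequence in which every term has mass at most `η` on the level set of each later
  -- term.
  obtain ⟨f, hf1, hf2⟩ := exists_seq_of_forall_finset_exists
    (fun m => δ ≤ ∫ ω, |g m ω| ∂P)
    (fun i j => ∫ ω, {ω | η < |g j ω|}.indicator (fun ω => |g i ω|) ω ∂P ≤ η) (fun s _ => by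
      have h : ∀ᶠ j in Filter.atTop, ∀ i ∈ s,
          ∫ ω, {ω | η < |g j ω|}.indicator (fun ω => |g i ω|) ω ∂P < η :=
        (Filter.eventually_all_finset s).2 fun i _ => (hlim i).eventually_lt_const hη0
      obtain ⟨M, hM⟩ := Filter.eventually_atTop.1 h
      obtain ⟨n, hn, hδn⟩ := hfr M
      refine ⟨n, ?_, fun i hi => (hM n hn i hi).le⟩
      rwa [Real.dist_eq, sub_zero, abs_of_nonneg (integral_nonneg fun _ => abs_nonneg _)] at hδn)
  let E : Fin N → Set Ω := fun k => {ω | η < |g (f k) ω|}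
  -- Deleting the later level sets makes the humps disjoint and costs each at most `N * η`.
  let A : Fin N → Set Ω := fun k => E k \ ⋃ j, ⋃ _ : k < j, E j
  have hA : ∀ k, MeasurableSet (A k) := fun k =>
    (hE _).diff (MeasurableSet.iUnion fun j => MeasurableSet.iUnion fun _ => hE _)
  have hdisj : Pairwise (Function.onFun Disjoint A) := by
    have key : ∀ k l, k < l → Disjoint (A k) (A l) := fun k l hkl =>
      Set.disjoint_left.2 fun ω hk hl => hk.2 (Set.mem_iUnion₂.2 ⟨l, hkl, hl.1⟩)
    intro k l hkl
    rcases lt_or_gt_of_ne hkl with h | h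
    · exact key k l h
    · exact (key l k h).symm
  have hpt : ∀ (k : Fin N) ω, |g (f k) ω| ≤ η + (A k).indicator (fun ω => |g (f k) ω|) ω +
      ∑ j : Fin N, if k < j then (E j).indicator (fun ω => |g (f k) ω|) ω else 0 := by
    intro k ω
    have hs0 : ∀ j : Fin N, 0 ≤ if k < j then (E j).indicator (fun ω => |g (f k) ω|) ω else 0 :=
      fun j => by
        split_ifs
        · exact Set.indicator_nonneg (fun _ _ => abs_nonneg _) _
        · exact le_rfl
    have hs := Finset.sum_nonneg fun j (_ : j ∈ Finset.univ) => hs0 j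
    have ha : 0 ≤ (A k).indicator (fun ω => |g (f k) ω|) ω :=
      Set.indicator_nonneg (fun _ _ => abs_nonneg _) _
    by_cases h1 : ω ∈ E k
    · by_cases h2 : ω ∈ ⋃ j, ⋃ _ : k < j, E j
      · obtain ⟨j, hkj, hj⟩ := Set.mem_iUnion₂.1 h2
        have := Finset.single_le_sum (fun j _ => hs0 j) (Finset.mem_univ j)
        rw [if_pos hkj, Set.indicator_of_mem hj] at this
        linarith
      · have : ω ∈ A k := ⟨h1, h2⟩
        rw [Set.indicator_of_mem this]
        linarith
    · have : |g (f k) ω| ≤ η := not_lt.1 h1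
      linarith
  have hint : ∀ k : Fin N, δ ≤ η + ∫ ω in A k, |g (f k) ω| ∂P + N * η := by
    intro k
    have hiA := (hi (f k)).abs.indicator (hA k)
    have hiE : ∀ j : Fin N, Integrable
        (fun ω => if k < j then (E j).indicator (fun ω => |g (f k) ω|) ω else 0) P := fun j => by
      split_ifs
      · exact (hi (f k)).abs.indicator (hE _)
      · exact integrable_zero _ _ _
    have hle : ∀ j : Fin N,
        ∫ ω, (if k < j then (E j).indicator (fun ω => |g (f k) ω|) ω else 0) ∂P ≤ η := fun j => by
      split_ifs with hkj
      · exact hf2 _ _ hkj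
      · simpa using hη0.le
    have h1 := integral_mono (hi (f k)).abs
      (((integrable_const η).add hiA).add (integrable_finsetSum Finset.univ fun j _ => hiE j))
      (fun ω => by simpa using hpt k ω)
    have h2 : ∫ ω, (∑ j : Fin N, if k < j then (E j).indicator (fun ω => |g (f k) ω|) ω else 0) ∂P
        ≤ N * η := by
      rw [integral_finsetSum _ fun j _ => hiE j]
      refine (Finset.sum_le_card_nsmul _ _ η fun j _ => hle j).trans ?_
      simp
    rw [integral_add' ((integrable_const η).add hiA)
      (integrable_finsetSum Finset.univ fun j _ => hiE j),
      integral_add' (integrable_const η) hiA] at h1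
    have h3 : ∫ ω, (A k).indicator (fun ω => |g (f k) ω|) ω ∂P = ∫ ω in A k, |g (f k) ω| ∂P :=
      integral_indicator (hA k)
    have h4 : ∫ _ : Ω, η ∂P = η := by simp
    have h5 := hf1 k
    linarith
  have hsum := Finset.sum_le_sum fun k (_ : k ∈ Finset.univ) => hint k
  simp only [Finset.sum_add_distrib, Finset.sum_const, Finset.card_univ, Fintype.card_fin,
    nsmul_eq_mul] at hsum
  have hb := hC N (fun k => f k) A hA hdisj
  have h1 : (N : ℝ) * η = δ / 4 := by rw [hη]; field_simp
  have hs : √(N : ℝ) * √(N : ℝ) = N := Real.mul_self_sqrt hN0.le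
  have hN1 : (1 : ℝ) ≤ N := by exact_mod_cast Nat.one_le_iff_ne_zero.2 (by rintro rfl; simp at hN0)
  -- The humps total at least `N * δ / 2`, which outgrows `C * √N` by the choice of `N`.
  have h2 : N * δ / 2 ≤ C * √N := by
    rw [h1] at hsum
    nlinarith
  have hsq : 0 < √(N : ℝ) := Real.sqrt_pos.2 hN0
  have h3 : √(N : ℝ) * (δ / 2) ≤ C := by
    refine le_of_mul_le_mul_right ?_ hsq
    calc √(N : ℝ) * (δ / 2) * √N = (√N * √N) * δ / 2 := by ring
      _ ≤ _ := by rw [hs]; exact h2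
  have h4 : √(N : ℝ) ≤ 2 * C / δ := by
    rw [le_div_iff₀ hδ]; linarith
  have h5 := pow_le_pow_left₀ hsq.le h4 2
  rw [Real.sq_sqrt hN0.le] at h5
  linarith

end GlidingHump

end

section

set_option maxSynthPendingDepth 3

theorem tendsto_bilin {K : Type*} [TopologicalSpace K] [CompactSpace K]
    (α : C(K, ℝ) →L[ℝ] C(K, ℝ) →L[ℝ] ℝ) {u v : ℕ → C(K, ℝ)} {f g : C(K, ℝ)}
    (hu : Filter.Tendsto u Filter.atTop (nhds f)) (hv : Filter.Tendsto v Filter.atTop (nhds g)) :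
    Filter.Tendsto (fun n => α (u n) (v n)) Filter.atTop (nhds (α f g)) := by
  have h : Filter.Tendsto (fun n => (u n, v n)) Filter.atTop (nhds (f, g)) := hu.prodMk_nhds hv
  exact Filter.Tendsto.comp (g := fun z : C(K, ℝ) × C(K, ℝ) => α z.1 z.2)
    (α.continuous₂.tendsto (f, g)) h

/-! ### Bilinear forms of processes with bounded second moments -/

section Processes

variable {K : Type*} [TopologicalSpace K] [CompactSpace K]
  {Ω : Type*} [MeasurableSpace Ω] {P : Measure Ω}

/-- `U` has measurable evaluations, bounded by `c` in `L²`. -/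
structure IsL2Process (P : Measure Ω) (U : Ω → C(K, ℝ)) (c : ℝ≥0) : Prop where
  measurable : ∀ t, Measurable fun ω => U ω t
  eLpNorm_le : ∀ t, eLpNorm (fun ω => U ω t) 2 P ≤ c

theorem eLpNorm_two_le_iff {f : Ω → ℝ} {c : ℝ≥0} :
    eLpNorm f 2 P ≤ c ↔ ∫⁻ ω, ‖f ω‖ₑ ^ 2 ∂P ≤ (c : ℝ≥0∞) ^ 2 := by
  have h := eLpNorm_nnreal_pow_eq_lintegral (μ := P) (f := f) (p := 2) two_ne_zero
  simp only [NNReal.coe_ofNat, ENNReal.rpow_ofNat, ENNReal.coe_ofNat] at h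
  rw [← h, ENNReal.pow_le_pow_left_iff two_ne_zero]

namespace IsL2Process

variable {U W : Ω → C(K, ℝ)} {a b : ℝ≥0}

theorem memLp (hU : IsL2Process P U a) (t : K) : MemLp (fun ω => U ω t) 2 P :=
  ⟨(hU.measurable t).aestronglyMeasurable, (hU.eLpNorm_le t).trans_lt ENNReal.coe_lt_top⟩

theorem sub (hU : IsL2Process P U a) (hW : IsL2Process P W b) :
    IsL2Process P (fun ω => U ω - W ω) (a + b) where
  measurable t := (hU.measurable t).sub (hW.measurable t)
  eLpNorm_le t := by
    refine (eLpNorm_sub_le (hU.memLp t).1 (hW.memLp t).1 one_le_two).trans ?_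
    rw [ENNReal.coe_add]
    exact add_le_add (hU.eLpNorm_le t) (hW.eLpNorm_le t)

theorem approx (hU : IsL2Process P U a) (π : PointedPartition K) :
    IsL2Process P (fun ω => π.approx (U ω)) a where
  measurable t := by
    simp only [PointedPartition.approx_apply]
    exact Finset.measurable_fun_sum _ fun i _ => (hU.measurable _).mul_const _
  eLpNorm_le t := by
    have e : (fun ω => π.approx (U ω) t) = ∑ i, π.fn i t • fun ω => U ω (π.pt i) := by
      ext ω
      simp [PointedPartition.approx_apply, mul_comm]
    rw [e]
    refine (eLpNorm_sum_le (fun i _ => ((hU.memLp _).1.const_smul _)) one_le_two).trans ?_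
    calc _ ≤ ∑ i, ‖π.fn i t‖ₑ * (a : ℝ≥0∞) := Finset.sum_le_sum fun i _ => by
          rw [eLpNorm_const_smul]
          gcongr
          exact hU.eLpNorm_le _
      _ = a := by
          rw [← Finset.sum_mul]
          simp only [Real.enorm_of_nonneg (π.nonneg _ t)]
          rw [← ENNReal.ofReal_sum_of_nonneg fun i _ => π.nonneg i t, π.sum_eq_one]
          simp

/-- At each `ω` at most one summand survives, so second moments add and `N` processes cost a factor
`√N` instead of `N`. -/
theorem sum_indicator {N : ℕ} {Z : Fin N → Ω → C(K, ℝ)} (hZ : ∀ k, IsL2Process P (Z k) b)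
    {A : Fin N → Set Ω} (hA : ∀ k, MeasurableSet (A k))
    (hd : Pairwise (Function.onFun Disjoint A)) :
    IsL2Process P (fun ω => ∑ k, (A k).indicator (Z k) ω) (NNReal.sqrt N * b) := by
  have e : ∀ (t : K) ω, (∑ k, (A k).indicator (Z k) ω) t =
      ∑ k, (A k).indicator (fun ω => Z k ω t) ω := fun t ω => by
    rw [ContinuousMap.sum_apply]
    refine Finset.sum_congr rfl fun k _ => ?_
    by_cases h : ω ∈ A k <;> simp [h]
  constructor
  · intro t
    simp only [e]
    exact Finset.measurable_fun_sum _ fun k _ => ((hZ k).measurable t).indicator (hA k)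
  · intro t
    rw [eLpNorm_two_le_iff]
    have hpt : ∀ ω, ‖(∑ k, (A k).indicator (Z k) ω) t‖ₑ ^ 2 ≤ ∑ k, ‖Z k ω t‖ₑ ^ 2 := fun ω => by
      rw [e]
      by_cases h : ∃ k, ω ∈ A k
      · obtain ⟨k, hk⟩ := h
        rw [Finset.sum_eq_single k (fun l _ hl => Set.indicator_of_notMem
          (fun hl' => (Set.disjoint_left.1 (hd hl) hl' hk)) _) (by simp),
          Set.indicator_of_mem hk]
        exact Finset.single_le_sum (f := fun k => ‖Z k ω t‖ₑ ^ 2) (fun _ _ => zero_le)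
          (Finset.mem_univ k)
      · push Not at h
        rw [Finset.sum_eq_zero fun k _ => Set.indicator_of_notMem (h k) _]
        simp
    refine (lintegral_mono hpt).trans ?_
    rw [lintegral_finsetSum _ fun k _ => ((hZ k).measurable t).enorm.pow_const 2]
    refine (Finset.sum_le_sum fun k _ => eLpNorm_two_le_iff.1 ((hZ k).eLpNorm_le t)).trans ?_
    simp only [Finset.sum_const, Finset.card_univ, Fintype.card_fin, nsmul_eq_mul]
    rw [ENNReal.coe_mul, mul_pow]
    norm_cast
    simp

theorem measurable_bilin_approx (hU : IsL2Process P U a) (hW : IsL2Process P W b)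
    (α : C(K, ℝ) →L[ℝ] C(K, ℝ) →L[ℝ] ℝ) (π ρ : PointedPartition K) :
    Measurable fun ω => α (π.approx (U ω)) (ρ.approx (W ω)) := by
  simp only [PointedPartition.bilin_approx]
  exact Finset.measurable_fun_sum _ fun i _ => Finset.measurable_fun_sum _ fun j _ =>
    ((hU.measurable _).mul (hW.measurable _)).const_mul _

theorem integrable_mul (hU : IsL2Process P U a) (hW : IsL2Process P W b) (s t : K) :
    Integrable (fun ω => U ω s * W ω t) P :=
  (hU.memLp s).integrable_mul (hW.memLp t)

theorem integral_bilin_approx (hU : IsL2Process P U a) (hW : IsL2Process P W b)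
    (α : C(K, ℝ) →L[ℝ] C(K, ℝ) →L[ℝ] ℝ) (π ρ : PointedPartition K) :
    ∫ ω, α (π.approx (U ω)) (ρ.approx (W ω)) ∂P =
      ∑ i, ∑ j, α (π.fn i) (ρ.fn j) * ∫ ω, U ω (π.pt i) * W ω (ρ.pt j) ∂P := by
  simp only [PointedPartition.bilin_approx]
  rw [integral_finsetSum _ fun i _ => integrable_finsetSum _ fun j _ =>
    (hU.integrable_mul hW _ _).const_mul _]
  refine Finset.sum_congr rfl fun i _ => ?_
  rw [integral_finsetSum _ fun j _ => (hU.integrable_mul hW _ _).const_mul _]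
  simp only [integral_const_mul]

/-- The sign of the form is absorbed into `U` without changing the `L²` norms of its evaluations.
What remains is a matrix form in inner products of `L²(P)`, where Grothendieck's inequality applies.
-/
theorem lintegral_bilin_approx_le (hU : IsL2Process P U a) (hW : IsL2Process P W b)
    (α : C(K, ℝ) →L[ℝ] C(K, ℝ) →L[ℝ] ℝ) (π ρ : PointedPartition K) :
    ∫⁻ ω, ‖α (π.approx (U ω)) (ρ.approx (W ω))‖ₑ ∂P ≤ ENNReal.ofReal (8 * ‖α‖ * (a * b)) := by
  set F : Ω → ℝ := fun ω => α (π.approx (U ω)) (ρ.approx (W ω)) with hF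
  have hFm : Measurable F := hU.measurable_bilin_approx hW α π ρ
  have hFi : Integrable F P := by
    rw [hF]
    simp only [PointedPartition.bilin_approx]
    exact integrable_finsetSum _ fun i _ => integrable_finsetSum _ fun j _ =>
      (hU.integrable_mul hW _ _).const_mul _
  rw [← ofReal_integral_norm_eq_lintegral_enorm hFi]
  refine ENNReal.ofReal_le_ofReal ?_
  let σ : Ω → ℝ := fun ω => if 0 ≤ F ω then 1 else -1
  have hσ : Measurable σ := Measurable.ite (measurableSet_le measurable_const hFm)
    measurable_const measurable_const
  have hσn : ∀ ω, ‖σ ω‖ₑ = 1 := fun ω => by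
    simp only [σ]; split_ifs <;> simp
  have hσU : IsL2Process P (fun ω => σ ω • U ω) a := by
    refine ⟨fun t => hσ.mul (hU.measurable t), fun t => ?_⟩
    rw [eLpNorm_two_le_iff]
    have : ∀ ω, ‖(σ ω • U ω) t‖ₑ = ‖U ω t‖ₑ := fun ω => by
      rw [ContinuousMap.smul_apply, enorm_smul, hσn, one_mul]
    simp only [this]
    exact eLpNorm_two_le_iff.1 (hU.eLpNorm_le t)
  have hnorm : ∀ {V : Ω → C(K, ℝ)} {c : ℝ≥0} (hV : IsL2Process P V c) (t : K),
      ‖(hV.memLp t).toLp‖ ≤ c := fun hV t => by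
    rw [Lp.norm_toLp]
    exact ENNReal.toReal_le_of_le_ofReal NNReal.zero_le_coe (by simpa using hV.eLpNorm_le t)
  have hG := grothendieck_inequality_of_norm_le (π.abs_sum_bilin_le ρ α)
    (fun i => (hσU.memLp (π.pt i)).toLp) (fun j => (hW.memLp (ρ.pt j)).toLp)
    a.coe_nonneg b.coe_nonneg (fun i => hnorm hσU _) (fun j => hnorm hW _)
  refine le_trans (le_of_eq ?_) ((le_abs_self _).trans hG)
  have hin : ∀ i j, inner ℝ (hσU.memLp (π.pt i)).toLp (hW.memLp (ρ.pt j)).toLp =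
      ∫ ω, (σ ω • U ω) (π.pt i) * W ω (ρ.pt j) ∂P := fun i j => by
    rw [L2.inner_def]
    refine integral_congr_ae ?_
    filter_upwards [(hσU.memLp (π.pt i)).coeFn_toLp, (hW.memLp (ρ.pt j)).coeFn_toLp]
      with ω h1 h2
    rw [h1, h2]
    simp [mul_comm]
  simp only [hin]
  rw [← hσU.integral_bilin_approx hW α π ρ]
  refine integral_congr_ae (Filter.Eventually.of_forall fun ω => ?_)
  simp only [map_smul, smul_apply, smul_eq_mul]
  change ‖F ω‖ = σ ω * F ω
  simp only [σ, Real.norm_eq_abs]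
  split_ifs with h
  · rw [abs_of_nonneg h, one_mul]
  · rw [abs_of_neg (not_le.1 h)]; ring

variable [TopologicalSpace.MetrizableSpace K]

/-- Only evaluations are known to be measurable; the form is a pointwise limit of polynomials in
finitely many of them. -/
theorem measurable_bilin (hU : IsL2Process P U a) (hW : IsL2Process P W b)
    (α : C(K, ℝ) →L[ℝ] C(K, ℝ) →L[ℝ] ℝ) : Measurable fun ω => α (U ω) (W ω) := by
  obtain ⟨π, hπ⟩ := PointedPartition.exists_seq_tendsto K
  refine measurable_of_tendsto_metrizable
    (fun n => hU.measurable_bilin_approx hW α (π n) (π n)) (tendsto_pi_nhds.2 fun ω => ?_)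
  exact tendsto_bilin α (hπ (U ω)) (hπ (W ω))

/-- Grothendieck's inequality for a bounded bilinear form on `C(K)`, evaluated at processes with
bounded second moments. -/
theorem lintegral_bilin_le (hU : IsL2Process P U a) (hW : IsL2Process P W b)
    (α : C(K, ℝ) →L[ℝ] C(K, ℝ) →L[ℝ] ℝ) :
    ∫⁻ ω, ‖α (U ω) (W ω)‖ₑ ∂P ≤ ENNReal.ofReal (8 * ‖α‖ * (a * b)) := by
  obtain ⟨π, hπ⟩ := PointedPartition.exists_seq_tendsto K
  have hlim : ∀ ω, Filter.Tendsto
      (fun n => ‖α ((π n).approx (U ω)) ((π n).approx (W ω))‖ₑ) Filter.atTop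
      (nhds ‖α (U ω) (W ω)‖ₑ) := fun ω =>
    (tendsto_bilin α (hπ (U ω)) (hπ (W ω))).enorm
  -- Fatou's lemma; the bound does not depend on the partition.
  calc ∫⁻ ω, ‖α (U ω) (W ω)‖ₑ ∂P
      = ∫⁻ ω, Filter.liminf (fun n => ‖α ((π n).approx (U ω)) ((π n).approx (W ω))‖ₑ)
          Filter.atTop ∂P := lintegral_congr fun ω => (hlim ω).liminf_eq.symm
    _ ≤ Filter.liminf (fun n => ∫⁻ ω, ‖α ((π n).approx (U ω)) ((π n).approx (W ω))‖ₑ ∂P)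
          Filter.atTop :=
        lintegral_liminf_le fun n => (hU.measurable_bilin_approx hW α (π n) (π n)).enorm
    _ ≤ _ := Filter.liminf_le_of_frequently_le'
        (Filter.Frequently.of_forall fun n => hU.lintegral_bilin_approx_le hW α (π n) (π n))

theorem integrable_bilin (hU : IsL2Process P U a) (hW : IsL2Process P W b)
    (α : C(K, ℝ) →L[ℝ] C(K, ℝ) →L[ℝ] ℝ) : Integrable (fun ω => α (U ω) (W ω)) P :=
  ⟨(hU.measurable_bilin hW α).aestronglyMeasurable,
    (hU.lintegral_bilin_le hW α).trans_lt ENNReal.ofReal_lt_top⟩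

theorem integral_abs_bilin_le (hU : IsL2Process P U a) (hW : IsL2Process P W b)
    (α : C(K, ℝ) →L[ℝ] C(K, ℝ) →L[ℝ] ℝ) :
    ∫ ω, |α (U ω) (W ω)| ∂P ≤ 8 * ‖α‖ * (a * b) := by
  have := hU.lintegral_bilin_le hW α
  rw [← ofReal_integral_norm_eq_lintegral_enorm (hU.integrable_bilin hW α)] at this
  exact (ENNReal.ofReal_le_ofReal_iff (by positivity)).1 this

variable [IsProbabilityMeasure P]

/-- Grothendieck's bound for the glued process of `sum_indicator` is exactly the `√N` estimate that
the gliding hump criterion requires. -/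
theorem tendsto_integral_abs_bilin {Z : ℕ → Ω → C(K, ℝ)} (hU : IsL2Process P U a)
    (hZ : ∀ m, IsL2Process P (Z m) b) (hlim : ∀ ω, Filter.Tendsto (fun m => Z m ω) Filter.atTop
      (nhds 0)) (α : C(K, ℝ) →L[ℝ] C(K, ℝ) →L[ℝ] ℝ) :
    Filter.Tendsto (fun m => ∫ ω, |α (U ω) (Z m ω)| ∂P) Filter.atTop (nhds 0) := by
  refine tendsto_integral_abs_of_disjoint_bound (C := 8 * ‖α‖ * (a * b))
    (fun m => hU.measurable_bilin (hZ m) α)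
    (fun m => hU.integrable_bilin (hZ m) α) (fun ω => ?_) fun N m A hA hd => ?_
  · simpa using tendsto_bilin α (tendsto_const_nhds (x := U ω)) (hlim ω)
  · have h := hU.integral_abs_bilin_le (sum_indicator (fun k => hZ (m k)) hA hd) α
    have e : ∀ ω, |α (U ω) (∑ k, (A k).indicator (Z (m k)) ω)| =
        ∑ k, (A k).indicator (fun ω => |α (U ω) (Z (m k) ω)|) ω := fun ω => by
      by_cases hk : ∃ k, ω ∈ A k
      · obtain ⟨k, hk⟩ := hk
        have hn : ∀ l, l ≠ k → ω ∉ A l := fun l hl hl' => Set.disjoint_left.1 (hd hl) hl' hk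
        rw [Finset.sum_eq_single k (fun l _ hl => Set.indicator_of_notMem (hn l hl) _) (by simp),
          Finset.sum_eq_single k (fun l _ hl => Set.indicator_of_notMem (hn l hl) _) (by simp),
          Set.indicator_of_mem hk, Set.indicator_of_mem hk]
      · push Not at hk
        rw [Finset.sum_eq_zero fun k _ => Set.indicator_of_notMem (hk k) _,
          Finset.sum_eq_zero fun k _ => Set.indicator_of_notMem (hk k) _]
        simp
    simp only [e] at h
    rw [integral_finsetSum _ fun k _ => (hU.integrable_bilin (hZ (m k)) α).abs.indicator (hA k)]
      at h
    simp only [integral_indicator (hA _)] at h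
    refine h.trans (le_of_eq ?_)
    simp only [NNReal.coe_mul, Real.coe_sqrt, NNReal.coe_natCast]
    ring

theorem tendsto_integral_bilin_approx (hU : IsL2Process P U a)
    {π : ℕ → PointedPartition K} (hπ : ∀ f : C(K, ℝ),
      Filter.Tendsto (fun n => (π n).approx f) Filter.atTop (nhds f))
    (α : C(K, ℝ) →L[ℝ] C(K, ℝ) →L[ℝ] ℝ) :
    Filter.Tendsto (fun m => ∫ ω, α (U ω) ((π m).approx (U ω)) ∂P) Filter.atTop
      (nhds (∫ ω, α (U ω) (U ω) ∂P)) := by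
  have h := hU.tendsto_integral_abs_bilin (Z := fun m ω => (π m).approx (U ω) - U ω)
    (fun m => (hU.approx (π m)).sub hU)
    (fun ω => by simpa using (hπ (U ω)).sub_const (U ω)) α
  rw [tendsto_iff_norm_sub_tendsto_zero]
  refine squeeze_zero (fun _ => norm_nonneg _) (fun m => ?_) h
  rw [← integral_sub (hU.integrable_bilin (hU.approx (π m)) α) (hU.integrable_bilin hU α)]
  simp only [← map_sub]
  exact norm_integral_le_integral_norm _

end IsL2Process

/-- The arguments are approximated one at a time, because the convergence result keeps the other one
fixed. With both approximated, only the moments in `h` occur. -/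
theorem integral_bilin_eq_of_integral_mul_eq [TopologicalSpace.MetrizableSpace K]
    {Ω' : Type*} [MeasurableSpace Ω'] {Q : Measure Ω'} [IsProbabilityMeasure P]
    [IsProbabilityMeasure Q] {X : Ω → C(K, ℝ)} {Y : Ω' → C(K, ℝ)} {a b : ℝ≥0}
    (hX : IsL2Process P X a) (hY : IsL2Process Q Y b)
    (h : ∀ s t, ∫ ω, X ω s * X ω t ∂P = ∫ ω, Y ω s * Y ω t ∂Q)
    (α : C(K, ℝ) →L[ℝ] C(K, ℝ) →L[ℝ] ℝ) :
    ∫ ω, α (X ω) (X ω) ∂P = ∫ ω, α (Y ω) (Y ω) ∂Q := by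
  obtain ⟨π, hπ⟩ := PointedPartition.exists_seq_tendsto K
  have step : ∀ β : C(K, ℝ) →L[ℝ] C(K, ℝ) →L[ℝ] ℝ,
      (∀ m, ∫ ω, β (X ω) ((π m).approx (X ω)) ∂P = ∫ ω, β (Y ω) ((π m).approx (Y ω)) ∂Q) →
      ∫ ω, β (X ω) (X ω) ∂P = ∫ ω, β (Y ω) (Y ω) ∂Q := fun β hβ =>
    tendsto_nhds_unique (hX.tendsto_integral_bilin_approx hπ β)
      (by simpa only [hβ] using hY.tendsto_integral_bilin_approx hπ β)
  refine step α fun m => ?_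
  -- The flip moves the argument not yet approximated to the second place, where `step` acts.
  have := step (α.bilinearComp (ContinuousLinearMap.id ℝ _) (π m).approx).flip fun n => by
    simp only [ContinuousLinearMap.flip_apply, ContinuousLinearMap.bilinearComp_apply,
      ContinuousLinearMap.id_apply]
    rw [hX.integral_bilin_approx hX, hY.integral_bilin_approx hY]
    simp only [h]
  simpa only [ContinuousLinearMap.flip_apply, ContinuousLinearMap.bilinearComp_apply,
      ContinuousLinearMap.id_apply] using this

end Processes

/-! ### Tensor squares and their functionals -/

theorem update_pair_zero {B : Type*} (x y z : B) : Function.update ![x, y] 0 z = ![z, y] := by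
  ext i; fin_cases i <;> rfl

theorem update_pair_one {B : Type*} (x y z : B) : Function.update ![x, y] 1 z = ![x, z] := by
  ext i; fin_cases i <;> rfl

section TensorSquare

variable (B : Type*) [NormedAddCommGroup B] [NormedSpace ℝ B]

/-- The bilinear map `(x, y) ↦ x ⊗ y` into the algebraic tensor square. -/
noncomputable def tensorSquareMk : B →ₗ[ℝ] B →ₗ[ℝ] (⨂[ℝ] _ : Fin 2, B) :=
  LinearMap.mk₂ ℝ (fun x y => PiTensorProduct.tprod ℝ ![x, y])
    (fun x x' y => by
      simpa only [update_pair_zero] using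
        (PiTensorProduct.tprod ℝ (s := fun _ : Fin 2 => B)).map_update_add ![x, y] 0 x x')
    (fun c x y => by
      simpa only [update_pair_zero] using
        (PiTensorProduct.tprod ℝ (s := fun _ : Fin 2 => B)).map_update_smul ![x, y] 0 c x)
    (fun x y y' => by
      simpa only [update_pair_one] using
        (PiTensorProduct.tprod ℝ (s := fun _ : Fin 2 => B)).map_update_add ![x, y] 1 y y')
    (fun c x y => by
      simpa only [update_pair_one] using
        (PiTensorProduct.tprod ℝ (s := fun _ : Fin 2 => B)).map_update_smul ![x, y] 1 c y)

variable {B} in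
theorem tensorSquareMk_self (x : B) :
    tensorSquareMk B x x = PiTensorProduct.tprod ℝ fun _ : Fin 2 => x := by
  have : ![x, x] = fun _ : Fin 2 => x := by ext i; fin_cases i <;> rfl
  change PiTensorProduct.tprod ℝ ![x, x] = _
  rw [this]

/-- The bounded bilinear map `(x, y) ↦ x ⊗ y` into the projective tensor square. -/
noncomputable def projMk : B →L[ℝ] B →L[ℝ] ProjTensorPower 2 B :=
  LinearMap.mkContinuous₂
    ((tensorSquareMk B).compr₂ UniformSpace.Completion.toComplL.toLinearMap) 1 fun x y => by
      have h := PiTensorProduct.projectiveSeminorm_tprod_le (𝕜 := ℝ) (E := fun _ : Fin 2 => B) ![x, y]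
      simp only [Fin.prod_univ_two] at h
      rw [one_mul]
      exact (UniformSpace.Completion.norm_coe _).trans_le h

variable {B} in
theorem projMk_self (x : B) : projMk B x x = projPow 2 x := by
  rw [projPow, ← tensorSquareMk_self]
  rfl

/-- The bounded bilinear map `(x, y) ↦ x ⊗ y` into the injective tensor square. -/
noncomputable def injMk : B →L[ℝ] B →L[ℝ] InjTensorPower 2 B :=
  LinearMap.mkContinuous₂
    ((tensorSquareMk B).compr₂
      (UniformSpace.Completion.toComplL.toLinearMap ∘ₗ (toAlgInj 2 B).toLinearMap)) 1 fun x y => by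
      refine (UniformSpace.Completion.norm_coe (toAlgInj 2 B (tensorSquareMk B x y))).trans_le ?_
      have : Nonempty (DualBallFamily 2 B) := ⟨fun _ => ⟨0, by simp⟩⟩
      rw [norm_toAlgInj]
      refine ciSup_le fun ξ => ?_
      have e : tensorSquareMk B x y = PiTensorProduct.tprod ℝ ![x, y] := rfl
      have hb : ∀ (i : Fin 2) (z : B), |(ξ i).1 z| ≤ 1 * ‖z‖ := fun i z =>
        (ξ i).1.le_of_opNorm_le (mem_closedBall_zero_iff.1 (ξ i).2) z
      rw [e, tensorPairing_tprod, Fin.prod_univ_two, abs_mul, one_mul]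
      exact mul_le_mul (by simpa using hb 0 x) (by simpa using hb 1 y) (abs_nonneg _)
        (norm_nonneg _)

variable {B} in
theorem injMk_self (x : B) : injMk B x x = injPow 2 x := by
  rw [injPow, ← tensorSquareMk_self]
  rfl

variable {k : ℕ} {B}

/-- A bounded functional on a normed space extends to its completion. -/
theorem exists_extension_completion {E : Type*} [SeminormedAddCommGroup E] [NormedSpace ℝ E]
    (f : E →ₗ[ℝ] ℝ) {C : ℝ} (hf : ∀ x, |f x| ≤ C * ‖x‖) :
    ∃ ℓ : StrongDual ℝ (UniformSpace.Completion E), ∀ x : E, ℓ x = f x :=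
  ⟨(f.mkContinuous C hf).extend UniformSpace.Completion.toComplL, fun x =>
    (f.mkContinuous C hf).extend_eq (e := UniformSpace.Completion.toComplL)
      UniformSpace.Completion.denseRange_coe
      (UniformSpace.Completion.isUniformInducing_coe E) x⟩

/-- Applied to point evaluations, this recovers (iii) from the tensor moments. -/
theorem exists_projTensorPower_functional (ξ : Fin k → StrongDual ℝ B) (hξ : ∀ i, ‖ξ i‖ ≤ 1) :
    ∃ ℓ : StrongDual ℝ (ProjTensorPower k B), ∀ x, ℓ (projPow k x) = ∏ i, ξ i x := by
  obtain ⟨ℓ, hℓ⟩ := exists_extension_completion (tensorPairing ξ) (C := 1) fun u => by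
    have h := PiTensorProduct.norm_eval_le_projectiveSeminorm
      ((ContinuousMultilinearMap.mkPiAlgebra ℝ (Fin k) ℝ).compContinuousLinearMap ξ) u
    refine h.trans (mul_le_mul_of_nonneg_right ?_ (norm_nonneg u))
    refine (ContinuousMultilinearMap.norm_compContinuousLinearMap_le _ _).trans ?_
    rw [ContinuousMultilinearMap.norm_mkPiAlgebra, one_mul]
    exact Finset.prod_le_one (fun i _ => norm_nonneg _) (fun i _ => hξ i)
  exact ⟨ℓ, fun x => (hℓ _).trans (tensorPairing_tprod _ _)⟩

/-- Boundedness is immediate: `ξ` is one of the families in the supremum defining the injective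
norm. -/
theorem exists_injTensorPower_functional (ξ : Fin k → StrongDual ℝ B) (hξ : ∀ i, ‖ξ i‖ ≤ 1) :
    ∃ ℓ : StrongDual ℝ (InjTensorPower k B), ∀ x, ℓ (injPow k x) = ∏ i, ξ i x := by
  obtain ⟨ℓ, hℓ⟩ := exists_extension_completion
    (tensorPairing ξ ∘ₗ (toAlgInj k B).symm.toLinearMap) (C := 1) fun u => by
    obtain ⟨u, rfl⟩ := (toAlgInj k B).surjective u
    rw [one_mul, norm_toAlgInj]
    simp only [LinearMap.comp_apply, LinearEquiv.coe_coe, LinearEquiv.symm_apply_apply]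
    exact le_ciSup (bddAbove_tensorPairing u)
      (fun i => ⟨ξ i, mem_closedBall_zero_iff.2 (hξ i)⟩ : DualBallFamily k B)
  refine ⟨ℓ, fun x => (hℓ _).trans ?_⟩
  simp only [LinearMap.comp_apply, LinearEquiv.coe_coe, LinearEquiv.symm_apply_apply]
  exact tensorPairing_tprod _ _

end TensorSquare

/-! ### Existence of Dunford integrals -/

section Dunford

variable {Ω Ω' : Type*} [MeasurableSpace Ω] [MeasurableSpace Ω'] {P : Measure Ω} {Q : Measure Ω'}
  {V : Type*} [NormedAddCommGroup V] [NormedSpace ℝ V]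

theorem IsDunfordIntegral.equalExpectations {Z : Ω → V} {Z' : Ω' → V}
    {m : StrongDual ℝ (StrongDual ℝ V)} (hZ : IsDunfordIntegral P Z m)
    (hZ' : IsDunfordIntegral Q Z' m) (ℓ : StrongDual ℝ V) :
    EqualExpectations P Q (fun ω => ℓ (Z ω)) (fun ω => ℓ (Z' ω)) :=
  ⟨hZ.integrable ℓ, hZ'.integrable ℓ, (hZ.apply_eq ℓ).symm.trans (hZ'.apply_eq ℓ)⟩

theorem exists_isDunfordIntegral_of_bound {Z : Ω → V} {Z' : Ω' → V} {C : ℝ}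
    (hZ : ∀ ℓ : StrongDual ℝ V,
      EqualExpectations P Q (fun ω => ℓ (Z ω)) (fun ω => ℓ (Z' ω)))
    (hC : ∀ ℓ : StrongDual ℝ V, ∫ ω, |ℓ (Z ω)| ∂P ≤ C * ‖ℓ‖) :
    ∃ m, IsDunfordIntegral P Z m ∧ IsDunfordIntegral Q Z' m := by
  let m : StrongDual ℝ V →ₗ[ℝ] ℝ :=
    { toFun := fun ℓ => ∫ ω, ℓ (Z ω) ∂P
      map_add' := fun ℓ ℓ' => integral_add (hZ ℓ).1 (hZ ℓ').1
      map_smul' := fun c ℓ => integral_const_mul c _ }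
  exact ⟨m.mkContinuous C fun ℓ => (norm_integral_le_integral_norm _).trans (hC ℓ),
    ⟨fun ℓ => (hZ ℓ).1, fun ℓ => rfl⟩, ⟨fun ℓ => (hZ ℓ).2.1, fun ℓ => (hZ ℓ).2.2⟩⟩

variable {K : Type*} [TopologicalSpace K] [CompactSpace K] [TopologicalSpace.MetrizableSpace K]

/-- Each `ℓ ∘ τ` is a bilinear form of norm at most `‖ℓ‖ * ‖τ‖`, and Grothendieck's bound is linear
in that norm; hence the expectation lies in the bidual. Taking `τ` as either tensor product map
treats (iv) and (v) alike. -/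
theorem IsL2Process.exists_isDunfordIntegral {X : Ω → C(K, ℝ)} {Y : Ω' → C(K, ℝ)} {a : ℝ≥0}
    (hX : IsL2Process P X a)
    (h : ∀ α : C(K, ℝ) →L[ℝ] C(K, ℝ) →L[ℝ] ℝ,
      EqualExpectations P Q (fun ω => α (X ω) (X ω)) (fun ω => α (Y ω) (Y ω)))
    (τ : C(K, ℝ) →L[ℝ] C(K, ℝ) →L[ℝ] V) :
    ∃ m, IsDunfordIntegral P (fun ω => τ (X ω) (X ω)) m ∧
      IsDunfordIntegral Q (fun ω => τ (Y ω) (Y ω)) m := by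
  let β : StrongDual ℝ V → C(K, ℝ) →L[ℝ] C(K, ℝ) →L[ℝ] ℝ := fun ℓ =>
    (ContinuousLinearMap.compL ℝ C(K, ℝ) V ℝ ℓ).comp τ
  have hβ : ∀ ℓ, ‖β ℓ‖ ≤ ‖ℓ‖ * ‖τ‖ := fun ℓ => by
    refine ContinuousLinearMap.opNorm_le_bound₂ _ (by positivity) fun f g => ?_
    refine (ℓ.le_opNorm _).trans ?_
    rw [mul_assoc, mul_assoc]
    gcongr
    rw [← mul_assoc]
    exact τ.le_opNorm₂ f g
  refine exists_isDunfordIntegral_of_bound (C := 8 * ‖τ‖ * (a * a)) (fun ℓ => h (β ℓ)) fun ℓ => ?_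
  refine (hX.integral_abs_bilin_le hX (β ℓ)).trans ?_
  calc 8 * ‖β ℓ‖ * (a * a : ℝ) ≤ 8 * (‖ℓ‖ * ‖τ‖) * (a * a) := by gcongr; exact hβ ℓ
    _ = _ := by ring

theorem isL2Process_of_pointEvalSigma {X : Ω → C(K, ℝ)} (hX : Measurable[_, pointEvalSigma K] X)
    {C : ℝ≥0} (hC : ∀ t : K, ∫⁻ ω, ‖X ω t‖ₑ ^ 2 ∂P ≤ C) : IsL2Process P X (NNReal.sqrt C) where
  measurable t := by
    have h : Measurable[pointEvalSigma K, borel ℝ] fun f : C(K, ℝ) => f t :=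
      measurable_iff_comap_le.2 (le_iSup (fun t : K =>
        MeasurableSpace.comap (fun f : C(K, ℝ) => f t) (borel ℝ)) t)
    rw [← BorelSpace.measurable_eq (α := ℝ)] at h
    exact h.comp hX
  eLpNorm_le t := by
    rw [eLpNorm_two_le_iff]
    refine (hC t).trans_eq ?_
    norm_cast
    simp

end Dunford

theorem norm_evalCLM_le_one {K : Type*} [TopologicalSpace K] [CompactSpace K] (t : K) :
    ‖(ContinuousMap.evalCLM ℝ t : C(K, ℝ) →L[ℝ] ℝ)‖ ≤ 1 :=
  ContinuousLinearMap.opNorm_le_bound _ zero_le_one fun f => by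
    rw [one_mul]; exact f.norm_coe_le_norm t

end

/-! ### The equivalence of the five conditions -/

theorem theorem9p16 {K : Type*} [TopologicalSpace K] [CompactSpace K]
    [TopologicalSpace.MetrizableSpace K]
    {Ω Ω' : Type*} [MeasurableSpace Ω] [MeasurableSpace Ω']
    (P : Measure Ω) [IsProbabilityMeasure P] (Q : Measure Ω') [IsProbabilityMeasure Q]
    (X : Ω → C(K, ℝ)) (Y : Ω' → C(K, ℝ))
    (hX : Measurable[_, pointEvalSigma K] X) (hY : Measurable[_, pointEvalSigma K] Y)
    (hX2 : ∃ C : ℝ≥0, ∀ t : K, ∫⁻ ω, ‖X ω t‖ₑ ^ 2 ∂P ≤ C)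
    (hY2 : ∃ C : ℝ≥0, ∀ t : K, ∫⁻ ω, ‖Y ω t‖ₑ ^ 2 ∂Q ≤ C) :
    List.TFAE [
      ∀ α : C(K, ℝ) →L[ℝ] C(K, ℝ) →L[ℝ] ℝ,
        EqualExpectations P Q (fun ω => α (X ω) (X ω)) (fun ω => α (Y ω) (Y ω)),
      ∀ ξ₁ ξ₂ : StrongDual ℝ C(K, ℝ),
        EqualExpectations P Q (fun ω => ξ₁ (X ω) * ξ₂ (X ω)) (fun ω => ξ₁ (Y ω) * ξ₂ (Y ω)),
      ∀ t₁ t₂ : K,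
        EqualExpectations P Q (fun ω => X ω t₁ * X ω t₂) (fun ω => Y ω t₁ * Y ω t₂),
      EqualProjMomentsDunford 2 P Q X Y,
      EqualInjMomentsDunford 2 P Q X Y] := by
  obtain ⟨A, hA⟩ := hX2
  obtain ⟨B, hB⟩ := hY2
  have hXp := isL2Process_of_pointEvalSigma hX hA
  have hYp := isL2Process_of_pointEvalSigma hY hB
  have heval : ∀ (t₁ t₂ : K) (i : Fin 2),
      ‖(![ContinuousMap.evalCLM ℝ t₁, ContinuousMap.evalCLM ℝ t₂] :
        Fin 2 → StrongDual ℝ C(K, ℝ)) i‖ ≤ 1 := fun t₁ t₂ i => by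
    fin_cases i <;> exact norm_evalCLM_le_one _
  tfae_have 1 → 2 := fun h ξ₁ ξ₂ => by
    simpa using h (ξ₁.smulRight ξ₂)
  tfae_have 2 → 3 := fun h t₁ t₂ =>
    h (ContinuousMap.evalCLM ℝ t₁) (ContinuousMap.evalCLM ℝ t₂)
  tfae_have 3 → 1 := fun h α => ⟨hXp.integrable_bilin hXp α, hYp.integrable_bilin hYp α,
    integral_bilin_eq_of_integral_mul_eq hXp hYp (fun s t => (h s t).2.2) α⟩
  tfae_have 1 → 4 := fun h => by
    have := hXp.exists_isDunfordIntegral h (projMk C(K, ℝ))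
    simp only [projMk_self] at this
    exact this
  tfae_have 1 → 5 := fun h => by
    have := hXp.exists_isDunfordIntegral h (injMk C(K, ℝ))
    simp only [injMk_self] at this
    exact this
  tfae_have 4 → 3 := fun ⟨m, h1, h2⟩ t₁ t₂ => by
    obtain ⟨ℓ, hℓ⟩ := exists_projTensorPower_functional _ (heval t₁ t₂)
    simpa [hℓ, Fin.prod_univ_two] using h1.equalExpectations h2 ℓ
  tfae_have 5 → 3 := fun ⟨m, h1, h2⟩ t₁ t₂ => by
    obtain ⟨ℓ, hℓ⟩ := exists_injTensorPower_functional _ (heval t₁ t₂)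
    simpa [hℓ, Fin.prod_univ_two] using h1.equalExpectations h2 ℓ
  tfae_finish
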